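/- A continuum is a nonempty compact connected metric space; a subcontinuum of $X$ is a nonempty compact connected subset of $X$. A tree is the geometric realization of a finite connected acyclic graph. A continuum $X$ is tree-like if for every $\varepsilon>0$ there are a tree $T$ and a continuous map $f:X\to T$ such that $\operatorname{diam}(f^{-1}\{t\})<\varepsilon$ for every $t\in T$. The meager composant of a point $x\in X$ is the set $$M_x=\bigcup\{L\subset X: L\text{ is a nowhere dense subcontinuum of }X\text{ and }x\in L\},$$ and a subset $M\subset X$ is a meager composant of $X$ if $M=M_x$ for some $x\in X$. Let $X$ be a tree-like continuum with more than one point. Then $X$ has no proper open meager composant; that is, there is no meager composant $M$ of $X$ such that $M$ is open in $X$ and $M\neq X$. -/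

import Mathlib

/-- The geometric realization of a simple graph on a finite vertex set `V`, as a subspace of `V → ℝ`:
the vertices are the standard basis vectors, and the edge `uv` is the straight segment joining the
basis vectors of `u` and `v`. -/
def graphRealization {V : Type*} [DecidableEq V] (G : SimpleGraph V) : Set (V → ℝ) :=
  {p | (∃ v : V, p = Pi.single v 1) ∨
    ∃ u v : V, G.Adj u v ∧ p ∈ segment ℝ (Pi.single u 1 : V → ℝ) (Pi.single v 1)}

/-- A metric space (meant for a continuum) is tree-like if for every `ε > 0` it has a continuous map
to some (geometric, finite) tree all of whose fibres have diameter less than `ε`. -/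
def IsTreeLike (X : Type*) [MetricSpace X] : Prop :=
  ∀ ε : ℝ, 0 < ε → ∃ (n : ℕ) (T : SimpleGraph (Fin n)), T.IsTree ∧
    ∃ f : X → graphRealization T, Continuous f ∧
      ∀ t : graphRealization T, Metric.diam (f ⁻¹' {t}) < ε

/-- A subcontinuum of a metric space: a compact connected (in particular nonempty) subset. -/
def IsSubcontinuum {X : Type*} [MetricSpace X] (L : Set X) : Prop :=
  IsCompact L ∧ IsConnected L

/-- The meager composant of `x`: the union of all nowhere dense subcontinua containing `x`. -/
def meagerComposant {X : Type*} [MetricSpace X] (x : X) : Set X :=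
  ⋃₀ {L : Set X | IsSubcontinuum L ∧ IsNowhereDense L ∧ x ∈ L}

/-- `M` is a meager composant of the space if it is the meager composant of some point. -/
def IsMeagerComposant {X : Type*} [MetricSpace X] (M : Set X) : Prop :=
  ∃ x : X, M = meagerComposant x

/-! Tree-likeness is used only through hereditary unicoherence: as in a tree, closed connected sets
have connected intersections. Hence any two points x, y lie in a smallest subcontinuum, their hull
`continuumHull x y`, which is irreducible between them, and z is in the meager composant M of x
exactly when the hull of x and z is nowhere dense.

Suppose M is open and proper. Some y outside M can be chosen so that M ∩ K is dense in the hull K of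
x and y (`exists_continuumHull_subset_closure`). Baire category then gives a proper subcontinuum P
of K with x ∈ P and nonempty interior (`exists_subcontinuum_not_isNowhereDense`). Put Q = closure (K
\ P), connected by irreducibility of K. For z in P ∩ Q, the hull of x and z together with Q joins x
to y, so this hull contains the interior of P and z ∉ M. Now M ∩ K is connected, contains x ∈ P, is
covered by P and Q and misses P ∩ Q; so it lies in P. Density forces P = K, a contradiction. -/

/-! ### Connected subsets of trees -/

/-- Any two preconnected subsets of `S` have a preconnected intersection. -/
def PreconnectedInter {Y : Type*} [TopologicalSpace Y] (S : Set Y) : Prop :=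
  ∀ A ⊆ S, ∀ B ⊆ S, IsPreconnected A → IsPreconnected B → IsPreconnected (A ∩ B)

theorem IsPreconnected.mem_of_union_of_inter_subset_singleton {Y : Type*} [TopologicalSpace Y]
    {A S₁ S₂ : Set Y} {v : Y} (hA : IsPreconnected A) (h₁ : IsClosed S₁) (h₂ : IsClosed S₂)
    (hv : S₁ ∩ S₂ ⊆ {v}) (hAS : A ⊆ S₁ ∪ S₂) (hA₁ : (A ∩ S₁).Nonempty) (hA₂ : (A ∩ S₂).Nonempty) :
    v ∈ A := by
  obtain ⟨w, hwA, hw⟩ := isPreconnected_closed_iff.1 hA S₁ S₂ h₁ h₂ hAS hA₁ hA₂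
  obtain rfl : w = v := hv hw
  exact hwA

/-- A separation of `A ∩ S₁` would extend to one of `A`: the rest of `A` attaches only at `v`, so it
joins the piece containing `v`. -/
theorem IsPreconnected.inter_of_union_of_inter_subset_singleton {Y : Type*} [TopologicalSpace Y]
    {A S₁ S₂ : Set Y} {v : Y} (hA : IsPreconnected A) (h₁ : IsClosed S₁) (h₂ : IsClosed S₂)
    (hv : S₁ ∩ S₂ ⊆ {v}) (hAS : A ⊆ S₁ ∪ S₂) : IsPreconnected (A ∩ S₁) := by
  rcases (A ∩ S₁).eq_empty_or_nonempty with h | hA₁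
  · rw [h]; exact isPreconnected_empty
  by_cases hA₂ : (A ∩ S₂).Nonempty
  · have hvA := hA.mem_of_union_of_inter_subset_singleton h₁ h₂ hv hAS hA₁ hA₂
    have hv' : v ∈ S₁ := by
      obtain ⟨w, hwA, hw⟩ := isPreconnected_closed_iff.1 hA S₁ S₂ h₁ h₂ hAS hA₁ hA₂
      obtain rfl : w = v := hv hw
      exact hw.1
    have key : ∀ C D : Set Y, IsClosed C → IsClosed D → A ∩ S₁ ⊆ C ∪ D → v ∈ C →
        (A ∩ S₁ ∩ D).Nonempty → (A ∩ S₁ ∩ (C ∩ D)).Nonempty := by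
      rintro C D hC hD hCD hvC ⟨d, ⟨hdA, hd₁⟩, hdD⟩
      obtain ⟨w, hwA, hw, hwD, hw₁⟩ := isPreconnected_closed_iff.1 hA (S₂ ∪ (C ∩ S₁)) (D ∩ S₁)
        (h₂.union (hC.inter h₁)) (hD.inter h₁) (by
          intro a ha
          rcases hAS ha with h | h
          · rcases hCD ⟨ha, h⟩ with h' | h'
            · exact Or.inl (Or.inr ⟨h', h⟩)
            · exact Or.inr ⟨h', h⟩
          · exact Or.inl (Or.inl h))
        ⟨v, hvA, Or.inr ⟨hvC, hv'⟩⟩ ⟨d, hdA, hdD, hd₁⟩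
      rcases hw with hw | hw
      · obtain rfl : w = v := hv ⟨hw₁, hw⟩
        exact ⟨w, ⟨hwA, hw₁⟩, hvC, hwD⟩
      · exact ⟨w, ⟨hwA, hw₁⟩, hw.1, hwD⟩
    rw [isPreconnected_closed_iff]
    intro C D hC hD hCD hnC hnD
    rcases hCD ⟨hvA, hv'⟩ with h | h
    · exact key C D hC hD hCD h hnD
    · rw [Set.inter_comm C D]
      exact key D C hD hC (by rwa [Set.union_comm]) h hnC
  · have : A ∩ S₁ = A := by
      refine Set.inter_eq_left.2 fun a ha => (hAS ha).resolve_right fun h => hA₂ ⟨a, ha, h⟩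
    rwa [this]

/-- A connected set meeting both sides passes through `v`; hence the two connected parts of `A ∩ B`,
when both are nonempty, share `v`. -/
theorem PreconnectedInter.union {Y : Type*} [TopologicalSpace Y] {S₁ S₂ : Set Y} {v : Y}
    (H₁ : PreconnectedInter S₁) (H₂ : PreconnectedInter S₂) (h₁ : IsClosed S₁) (h₂ : IsClosed S₂)
    (hv : S₁ ∩ S₂ ⊆ {v}) : PreconnectedInter (S₁ ∪ S₂) := by
  intro A hAS B hBS hA hB
  have hv' : S₂ ∩ S₁ ⊆ {v} := by rwa [Set.inter_comm]
  have hAS' : A ⊆ S₂ ∪ S₁ := by rwa [Set.union_comm]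
  have hBS' : B ⊆ S₂ ∪ S₁ := by rwa [Set.union_comm]
  have c₁ : IsPreconnected ((A ∩ S₁) ∩ (B ∩ S₁)) :=
    H₁ _ Set.inter_subset_right _ Set.inter_subset_right
      (hA.inter_of_union_of_inter_subset_singleton h₁ h₂ hv hAS)
      (hB.inter_of_union_of_inter_subset_singleton h₁ h₂ hv hBS)
  have c₂ : IsPreconnected ((A ∩ S₂) ∩ (B ∩ S₂)) :=
    H₂ _ Set.inter_subset_right _ Set.inter_subset_right
      (hA.inter_of_union_of_inter_subset_singleton h₂ h₁ hv' hAS')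
      (hB.inter_of_union_of_inter_subset_singleton h₂ h₁ hv' hBS')
  have e : A ∩ B = ((A ∩ S₁) ∩ (B ∩ S₁)) ∪ ((A ∩ S₂) ∩ (B ∩ S₂)) := by
    ext a
    have := @hAS a
    simp only [Set.mem_inter_iff, Set.mem_union] at *
    tauto
  rw [e]
  rcases ((A ∩ S₁) ∩ (B ∩ S₁)).eq_empty_or_nonempty with h | ⟨p, ⟨hpA, hp₁⟩, hpB, -⟩
  · rwa [h, Set.empty_union]
  rcases ((A ∩ S₂) ∩ (B ∩ S₂)).eq_empty_or_nonempty with h | ⟨q, ⟨hqA, hq₂⟩, hqB, -⟩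
  · rwa [h, Set.union_empty]
  have hvA := hA.mem_of_union_of_inter_subset_singleton h₁ h₂ hv hAS ⟨p, hpA, hp₁⟩ ⟨q, hqA, hq₂⟩
  have hvB := hB.mem_of_union_of_inter_subset_singleton h₁ h₂ hv hBS ⟨p, hpB, hp₁⟩ ⟨q, hqB, hq₂⟩
  have hvS : v ∈ S₁ ∩ S₂ := by
    obtain ⟨w, -, hw⟩ := isPreconnected_closed_iff.1 hA S₁ S₂ h₁ h₂ hAS ⟨p, hpA, hp₁⟩ ⟨q, hqA, hq₂⟩
    obtain rfl : w = v := hv hw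
    exact hw
  exact c₁.union v ⟨⟨hvA, hvS.1⟩, hvB, hvS.1⟩ ⟨⟨hvA, hvS.2⟩, hvB, hvS.2⟩ c₂

theorem Set.Subsingleton.preconnectedInter {Y : Type*} [TopologicalSpace Y] {S : Set Y}
    (hS : S.Subsingleton) : PreconnectedInter S :=
  fun _ hA _ _ _ _ => (hS.anti (Set.inter_subset_left.trans hA)).isPreconnected

theorem preconnectedInter_real (S : Set ℝ) : PreconnectedInter S :=
  fun _ _ _ _ hA hB => (hA.ordConnected.inter hB.ordConnected).isPreconnected

/-- The coordinate at `l` inverts the parametrization of the segment, which reduces the claim to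
intervals of the line. -/
theorem preconnectedInter_segment {V : Type*} [DecidableEq V] {u l : V} (hul : u ≠ l) :
    PreconnectedInter (segment ℝ (Pi.single u 1 : V → ℝ) (Pi.single l 1)) := by
  intro A hA B hB cA cB
  set g : ℝ → V → ℝ := fun t => AffineMap.lineMap (Pi.single u 1 : V → ℝ) (Pi.single l 1) t
  have hg : Continuous g := AffineMap.lineMap_continuous
  have hgl : ∀ p ∈ segment ℝ (Pi.single u 1 : V → ℝ) (Pi.single l 1), g (p l) = p := by
    intro p hp
    rw [segment_eq_image_lineMap] at hp
    obtain ⟨t, -, rfl⟩ := hp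
    simp [g, AffineMap.lineMap_apply, hul.symm]
  have e : A ∩ B = g '' ((fun p => p l) '' A ∩ (fun p => p l) '' B) := by
    ext p
    constructor
    · rintro ⟨ha, hb⟩
      exact ⟨p l, ⟨⟨p, ha, rfl⟩, ⟨p, hb, rfl⟩⟩, hgl p (hA ha)⟩
    · rintro ⟨_, ⟨⟨a, ha, rfl⟩, ⟨b, hb, hab⟩⟩, rfl⟩
      refine ⟨by simpa only [hgl a (hA ha)] using ha, ?_⟩
      have : g (a l) = b := by rw [← hgl b (hB hb)]; exact congrArg g hab.symm
      rwa [this]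
  rw [e]
  refine IsPreconnected.image ?_ g hg.continuousOn
  exact preconnectedInter_real Set.univ _ (Set.subset_univ _) _ (Set.subset_univ _)
    (cA.image _ (continuous_apply l).continuousOn) (cB.image _ (continuous_apply l).continuousOn)

/-- The realization of a graph on `W` whose vertices are placed at the basis vectors of `V → ℝ`
selected by `e : W → V`. -/
def realizationVia {V W : Type*} [DecidableEq V] (G : SimpleGraph W) (e : W → V) : Set (V → ℝ) :=
  {p | (∃ w : W, p = Pi.single (e w) 1) ∨
    ∃ u w : W, G.Adj u w ∧ p ∈ segment ℝ (Pi.single (e u) 1 : V → ℝ) (Pi.single (e w) 1)}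

theorem isCompact_segment_real {V : Type*} (a b : V → ℝ) : IsCompact (segment ℝ a b) := by
  rw [segment_eq_image_lineMap]
  exact isCompact_Icc.image AffineMap.lineMap_continuous

theorem isClosed_realizationVia {V W : Type*} [DecidableEq V] [Finite W]
    (G : SimpleGraph W) (e : W → V) : IsClosed (realizationVia G e) := by
  have : realizationVia G e = (⋃ w : W, {Pi.single (e w) 1}) ∪
      ⋃ (u : W) (w : {w : W // G.Adj u w}),
        segment ℝ (Pi.single (e u) 1 : V → ℝ) (Pi.single (e w) 1) := by
    ext p
    simp [realizationVia, eq_comm]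
  rw [this]
  refine (isClosed_iUnion_of_finite fun _ => isClosed_singleton).union
    (isClosed_iUnion_of_finite fun u => isClosed_iUnion_of_finite fun w =>
      (isCompact_segment_real _ _).isClosed)

theorem realizationVia_apply_eq_zero {V W : Type*} [DecidableEq V] {G : SimpleGraph W}
    {e : W → V} {l : V} (hl : ∀ w, e w ≠ l) {p : V → ℝ} (hp : p ∈ realizationVia G e) :
    p l = 0 := by
  rcases hp with ⟨w, rfl⟩ | ⟨u, w, -, hp⟩
  · simp [(hl w).symm]
  · obtain ⟨a, b, -, -, -, rfl⟩ := hp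
    simp [(hl w).symm, (hl u).symm]

theorem realizationVia_eq_union_of_leaf {V W : Type*} [DecidableEq V] {G : SimpleGraph W}
    (e : W → V) {l u : W} (hlu : G.Adj l u) (hu : ∀ w, G.Adj l w → w = u) :
    realizationVia G e = realizationVia (G.induce {l}ᶜ) (fun w => e w) ∪
      segment ℝ (Pi.single (e u) 1 : V → ℝ) (Pi.single (e l) 1) := by
  ext p
  constructor
  · rintro (⟨w, rfl⟩ | ⟨a, b, hab, hp⟩)
    · by_cases hw : w = l
      · subst hw
        exact Or.inr (right_mem_segment _ _ _)
      · exact Or.inl (Or.inl ⟨⟨w, hw⟩, rfl⟩)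
    · by_cases ha : a = l
      · subst ha
        rw [hu b hab] at hp
        exact Or.inr (by rwa [segment_symm])
      · by_cases hb : b = l
        · subst hb
          rw [hu a hab.symm] at hp
          exact Or.inr hp
        · exact Or.inl (Or.inr ⟨⟨a, ha⟩, ⟨b, hb⟩, by simpa using hab, hp⟩)
  · rintro ((⟨w, rfl⟩ | ⟨a, b, hab, hp⟩) | hp)
    · exact Or.inl ⟨w, rfl⟩
    · exact Or.inr ⟨a, b, by simpa using hab, hp⟩
    · exact Or.inr ⟨u, l, hlu.symm, hp⟩

/-- Induction by removing a leaf, whose edge meets the remaining tree only at its other endpoint.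
The placement `e` keeps the ambient space fixed while the vertex type shrinks. -/
theorem SimpleGraph.IsTree.preconnectedInter_realizationVia {V : Type*} [DecidableEq V] (n : ℕ) :
    ∀ {W : Type} [Fintype W] {G : SimpleGraph W} {e : W → V}, Fintype.card W = n → G.IsTree →
      Function.Injective e → PreconnectedInter (realizationVia G e) := by
  classical
  induction n with
  | zero =>
    intro W _ G e hc hG _
    have := hG.connected.nonempty
    exact absurd hc Fintype.card_ne_zero
  | succ n ih =>
    intro W _ G e hc hG he
    rcases subsingleton_or_nontrivial W with hW | hW
    · refine Set.Subsingleton.preconnectedInter ?_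
      rintro p (⟨w, rfl⟩ | ⟨u, w, h, -⟩) q (⟨w', rfl⟩ | ⟨u', w', h', -⟩)
      · rw [Subsingleton.elim w w']
      · exact absurd (Subsingleton.elim u' w') h'.ne
      · exact absurd (Subsingleton.elim u w) h.ne
      · exact absurd (Subsingleton.elim u w) h.ne
    · obtain ⟨l, hl⟩ := hG.exists_vert_degree_one_of_nontrivial
      obtain ⟨u, hlu, hu⟩ := SimpleGraph.degree_eq_one_iff_existsUnique_adj.1 hl
      have hne : e u ≠ e l := fun h => hlu.ne (he h).symm
      rw [realizationVia_eq_union_of_leaf e hlu hu]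
      refine PreconnectedInter.union (v := Pi.single (e u) 1)
        (ih ?_ ⟨hG.connected.induce_compl_singleton_of_degree_eq_one hl, hG.isAcyclic.induce _⟩
          (he.comp Subtype.val_injective))
        (preconnectedInter_segment hne) (isClosed_realizationVia _ _)
        (isCompact_segment_real _ _).isClosed ?_
      · rw [Fintype.card_compl_set, hc]
        simp
      · rintro p ⟨hp, hs⟩
        have h0 : p (e l) = 0 := realizationVia_apply_eq_zero
          (fun w h => w.2 (he h)) hp
        obtain ⟨a, b, -, -, hab, rfl⟩ := hs
        have hb : b = 0 := by simpa [hne.symm] using h0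
        subst hb
        obtain rfl : a = 1 := by simpa using hab
        simp

theorem SimpleGraph.IsTree.preconnectedInter_graphRealization {n : ℕ} {T : SimpleGraph (Fin n)}
    (hT : T.IsTree) : PreconnectedInter (graphRealization T) :=
  SimpleGraph.IsTree.preconnectedInter_realizationVia (e := id) n (Fintype.card_fin n) hT
    Function.injective_id

/-! ### Hereditary unicoherence of tree-like continua -/

/-- If `A ∩ B` split into disjoint closed `E` and `F`, take a map to a tree with fibres too small to
join the neighbourhoods `E'` and `F'`, or to join `A` to `B` away from both. The connected
intersection of the images of `A` and `B` would then be separated. -/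
theorem IsTreeLike.isPreconnected_inter {X : Type*} [MetricSpace X] [CompactSpace X]
    (hX : IsTreeLike X) {A B : Set X} (hA : IsClosed A) (hB : IsClosed B)
    (cA : IsPreconnected A) (cB : IsPreconnected B) : IsPreconnected (A ∩ B) := by
  rw [isPreconnected_closed_iff]
  intro C D hC hD hCD hnC hnD
  by_contra hne
  set E := A ∩ B ∩ C
  set F := A ∩ B ∩ D
  have hE : IsClosed E := (hA.inter hB).inter hC
  have hF : IsClosed F := (hA.inter hB).inter hD
  have hEF : Disjoint E F := by
    rw [Set.disjoint_left]
    rintro w ⟨hw, hwC⟩ ⟨-, hwD⟩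
    exact hne ⟨w, hw, hwC, hwD⟩
  obtain ⟨δ, hδ, hdis⟩ := hEF.exists_cthickenings hE.isCompact hF
  set E' := Metric.cthickening δ E
  set F' := Metric.cthickening δ F
  -- points of `A` and `B` that are close to each other are close to `A ∩ B`
  have hsep : ∃ ε > 0, ∀ a ∈ A, ∀ b ∈ B, dist a b < ε → a ∈ E' ∪ F' := by
    set Z : Set X := A ∩ (Metric.thickening δ E ∪ Metric.thickening δ F)ᶜ
    have hZ : IsClosed Z := hA.inter
      (Metric.isOpen_thickening.union Metric.isOpen_thickening).isClosed_compl
    have hZB : Disjoint Z B := by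
      rw [Set.disjoint_left]
      rintro w ⟨hwA, hw⟩ hwB
      rcases hCD ⟨hwA, hwB⟩ with h | h
      · exact hw (Or.inl (Metric.self_subset_thickening hδ _ ⟨⟨hwA, hwB⟩, h⟩))
      · exact hw (Or.inr (Metric.self_subset_thickening hδ _ ⟨⟨hwA, hwB⟩, h⟩))
    obtain ⟨ε, hε, hd⟩ := hZB.exists_thickenings hZ.isCompact hB
    refine ⟨ε, hε, fun a ha b hb hab => ?_⟩
    by_contra hcon
    have haZ : a ∈ Z := by
      refine ⟨ha, fun h => hcon ?_⟩
      exact h.imp (fun h => Metric.thickening_subset_cthickening _ _ h)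
        (fun h => Metric.thickening_subset_cthickening _ _ h)
    exact Set.disjoint_left.1 hd (Metric.mem_thickening_iff.2 ⟨a, haZ, by rwa [dist_comm]⟩)
      (Metric.self_subset_thickening hε _ hb)
  have hsep' : ∃ ε > 0, ∀ a ∈ E', ∀ b ∈ F', ε ≤ dist a b := by
    obtain ⟨ε, hε, hd⟩ := hdis.exists_thickenings
      (Metric.isClosed_cthickening (E := E)).isCompact Metric.isClosed_cthickening
    refine ⟨ε, hε, fun a ha b hb => ?_⟩
    by_contra! hab
    exact Set.disjoint_left.1 hd (Metric.mem_thickening_iff.2 ⟨a, ha, by rwa [dist_comm]⟩)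
      (Metric.self_subset_thickening hε _ hb)
  obtain ⟨ε₁, hε₁, h₁⟩ := hsep
  obtain ⟨ε₂, hε₂, h₂⟩ := hsep'
  obtain ⟨n, T, hT, f, hf, hd⟩ := hX (min ε₁ ε₂) (lt_min hε₁ hε₂)
  have hclose : ∀ a b, f a = f b → dist a b < min ε₁ ε₂ := fun a b hab =>
    (Metric.dist_le_diam_of_mem (Metric.isBounded_of_compactSpace) (by simpa using hab)
      (by simp)).trans_lt (hd (f b))
  set g : X → Fin n → ℝ := fun x => (f x : Fin n → ℝ)
  have hg : Continuous g := continuous_subtype_val.comp hf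
  have hclose' : ∀ a b, g a = g b → dist a b < min ε₁ ε₂ := fun a b hab =>
    hclose a b (Subtype.ext hab)
  have hsub : ∀ S : Set X, g '' S ⊆ graphRealization T := by
    rintro S _ ⟨x, -, rfl⟩
    exact (f x).2
  have hcon := hT.preconnectedInter_graphRealization _ (hsub A) _ (hsub B)
    (cA.image g hg.continuousOn) (cB.image g hg.continuousOn)
  have hcl : ∀ S : Set X, IsClosed S → IsClosed (g '' S) := fun S hS =>
    (hS.isCompact.image hg).isClosed
  obtain ⟨t, -, ⟨a, ⟨ha, haE⟩, hat⟩, ⟨b, ⟨hb, hbF⟩, hbt⟩⟩ := isPreconnected_closed_iff.1 hcon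
    (g '' (A ∩ E')) (g '' (A ∩ F'))
    (hcl _ (hA.inter Metric.isClosed_cthickening)) (hcl _ (hA.inter Metric.isClosed_cthickening))
    (by
      rintro _ ⟨⟨a, ha, rfl⟩, ⟨b, hb, hba⟩⟩
      rcases h₁ a ha b hb ((hclose' a b hba.symm).trans_le (min_le_left _ _)) with h | h
      · exact Or.inl ⟨a, ⟨ha, h⟩, rfl⟩
      · exact Or.inr ⟨a, ⟨ha, h⟩, rfl⟩)
    (by
      obtain ⟨w, ⟨hwA, hwB⟩, hwC⟩ := hnC
      exact ⟨g w, ⟨⟨w, hwA, rfl⟩, ⟨w, hwB, rfl⟩⟩, w,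
        ⟨hwA, Metric.self_subset_cthickening _ ⟨⟨hwA, hwB⟩, hwC⟩⟩, rfl⟩)
    (by
      obtain ⟨w, ⟨hwA, hwB⟩, hwD⟩ := hnD
      exact ⟨g w, ⟨⟨w, hwA, rfl⟩, ⟨w, hwB, rfl⟩⟩, w,
        ⟨hwA, Metric.self_subset_cthickening _ ⟨⟨hwA, hwB⟩, hwD⟩⟩, rfl⟩)
  exact absurd ((hclose' a b (hat.trans hbt.symm)).trans_le (min_le_right _ _))
    (not_lt.2 (h₂ a haE b hbF))

/-! ### Hulls and irreducible continua -/

/-- Closed connected subsets have connected (possibly empty)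
intersections. -/
def HereditarilyUnicoherent (X : Type*) [TopologicalSpace X] : Prop :=
  ∀ A B : Set X, IsClosed A → IsClosed B → IsPreconnected A → IsPreconnected B →
    IsPreconnected (A ∩ B)

/-- The intersection of all subcontinua containing `x` and `y`. -/
def continuumHull {X : Type*} [MetricSpace X] (x y : X) : Set X :=
  ⋂₀ {L | IsSubcontinuum L ∧ x ∈ L ∧ y ∈ L}

theorem isPreconnected_iInter_of_directed {X ι : Type*} [TopologicalSpace X] [CompactSpace X]
    [T2Space X] [Nonempty ι] {V : ι → Set X} (hV : Directed (· ⊇ ·) V)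
    (hc : ∀ i, IsClosed (V i)) (hp : ∀ i, IsPreconnected (V i)) : IsPreconnected (⋂ i, V i) := by
  rw [isPreconnected_closed_iff]
  intro C D hC hD hCD hnC hnD
  by_contra hne
  have hI : IsClosed (⋂ i, V i) := isClosed_iInter hc
  have hdis : Disjoint ((⋂ i, V i) ∩ C) ((⋂ i, V i) ∩ D) := by
    rw [Set.disjoint_left]
    rintro w ⟨hw, hwC⟩ ⟨-, hwD⟩
    exact hne ⟨w, hw, hwC, hwD⟩
  obtain ⟨U, U', hU, hU', hCU, hDU', hUU'⟩ :=
    normal_separation (hI.inter hC) (hI.inter hD) hdis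
  obtain ⟨i, hi⟩ := exists_subset_nhds_of_isCompact' hV (fun i => (hc i).isCompact) hc
    (U := U ∪ U') (fun w hw => (hU.union hU').mem_nhds
      ((hCD hw).imp (fun h => hCU ⟨hw, h⟩) fun h => hDU' ⟨hw, h⟩))
  obtain ⟨c, hc, hcC⟩ := hnC
  obtain ⟨d, hd, hdD⟩ := hnD
  obtain ⟨w, -, hw, hw'⟩ := hp i U U' hU hU' hi ⟨c, Set.mem_iInter.1 hc i, hCU ⟨hc, hcC⟩⟩
    ⟨d, Set.mem_iInter.1 hd i, hDU' ⟨hd, hdD⟩⟩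
  exact Set.disjoint_left.1 hUU' hw hw'

section Hull

variable {X : Type*} [MetricSpace X] {x y z : X} {K L P : Set X}

theorem IsSubcontinuum.isClosed (hL : IsSubcontinuum L) : IsClosed L := hL.1.isClosed

theorem IsClosed.isSubcontinuum [CompactSpace X] (hc : IsClosed L) (hp : IsPreconnected L)
    (hx : x ∈ L) : IsSubcontinuum L := ⟨hc.isCompact, ⟨x, hx⟩, hp⟩

theorem left_mem_continuumHull (x y : X) : x ∈ continuumHull x y := fun _ hL => hL.2.1

theorem right_mem_continuumHull (x y : X) : y ∈ continuumHull x y := fun _ hL => hL.2.2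

theorem continuumHull_subset (hL : IsSubcontinuum L) (hx : x ∈ L) (hy : y ∈ L) :
    continuumHull x y ⊆ L := Set.sInter_subset_of_mem ⟨hL, hx, hy⟩

theorem isClosed_continuumHull (x y : X) : IsClosed (continuumHull x y) :=
  isClosed_sInter fun _ hL => hL.1.isClosed

/-- By unicoherence the subcontinua containing both points are closed under pairwise intersection,
hence directed. -/
theorem HereditarilyUnicoherent.isSubcontinuum_continuumHull [CompactSpace X] [ConnectedSpace X]
    (hX : HereditarilyUnicoherent X) (x y : X) : IsSubcontinuum (continuumHull x y) := by
  refine (isClosed_continuumHull x y).isSubcontinuum ?_ (left_mem_continuumHull x y)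
  rw [continuumHull, Set.sInter_eq_iInter]
  have : Nonempty {L : Set X | IsSubcontinuum L ∧ x ∈ L ∧ y ∈ L} :=
    ⟨⟨Set.univ, ⟨isCompact_univ, isConnected_univ⟩, trivial, trivial⟩⟩
  refine isPreconnected_iInter_of_directed ?_ (fun L => L.2.1.isClosed) fun L => L.2.1.2.2
  rintro ⟨L, hL, hxL, hyL⟩ ⟨L', hL', hxL', hyL'⟩
  exact ⟨⟨L ∩ L', (hL.isClosed.inter hL'.isClosed).isSubcontinuum
    (hX _ _ hL.isClosed hL'.isClosed hL.2.2 hL'.2.2) (x := x) ⟨hxL, hxL'⟩,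
    ⟨hxL, hxL'⟩, ⟨hyL, hyL'⟩⟩, Set.inter_subset_left, Set.inter_subset_right⟩

theorem HereditarilyUnicoherent.mem_meagerComposant_iff [CompactSpace X] [ConnectedSpace X]
    (hX : HereditarilyUnicoherent X) :
    z ∈ meagerComposant x ↔ IsNowhereDense (continuumHull x z) := by
  constructor
  · rintro ⟨L, ⟨hL, hn, hx⟩, hz⟩
    exact hn.mono (continuumHull_subset hL hx hz)
  · intro h
    exact ⟨_, ⟨hX.isSubcontinuum_continuumHull x z, h, left_mem_continuumHull x z⟩,
      right_mem_continuumHull x z⟩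

theorem HereditarilyUnicoherent.continuumHull_subset_meagerComposant [CompactSpace X]
    [ConnectedSpace X] (hX : HereditarilyUnicoherent X) (hz : z ∈ meagerComposant x) :
    continuumHull x z ⊆ meagerComposant x := fun _ hw =>
  Set.mem_sUnion_of_mem hw ⟨hX.isSubcontinuum_continuumHull x z, hX.mem_meagerComposant_iff.1 hz,
    left_mem_continuumHull x z⟩

/-- If a continuum `K` is irreducible between `x` and `y`, then the complement in `K` of a
subcontinuum containing `x` has connected closure. -/
theorem isPreconnected_closure_diff_of_irreducible [CompactSpace X] (hK : IsSubcontinuum K)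
    (hirr : ∀ L ⊆ K, IsSubcontinuum L → x ∈ L → y ∈ L → L = K) (hP : IsSubcontinuum P)
    (hPK : P ⊆ K) (hx : x ∈ P) (hy : y ∈ K \ P) : IsPreconnected (closure (K \ P)) := by
  set Q := closure (K \ P)
  have hQc : IsClosed Q := isClosed_closure
  have hQK : Q ⊆ K := closure_minimal Set.sdiff_subset hK.isClosed
  have hKPQ : K ⊆ P ∪ Q := fun w hw => by
    by_cases h : w ∈ P
    · exact Or.inl h
    · exact Or.inr (subset_closure ⟨hw, h⟩)
  -- gluing to `P` one of two disjoint closed pieces of `Q` gives a connected set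
  have glue : ∀ C D E F : Set X, IsClosed C → IsClosed D → IsClosed E → IsClosed F →
      Q ⊆ C ∪ D → Q ∩ (C ∩ D) = ∅ → P ⊆ E → P ∪ (Q ∩ C) ⊆ E ∪ F →
      ((P ∪ (Q ∩ C)) ∩ F).Nonempty → ((P ∪ (Q ∩ C)) ∩ (E ∩ F)).Nonempty := by
    intro C D E F hC hD hE hF hQ hCD hPE hEF ⟨f, hf, hfF⟩
    rcases hf with hf | hf
    · exact ⟨f, Or.inl hf, hPE hf, hfF⟩
    -- With `P` inside `E`, the leftover piece `Q ∩ D` can be added to the `E` side, so a separation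
    -- by `E` and `F` would separate `K`.
    obtain ⟨w, -, hw, hwQ⟩ := isPreconnected_closed_iff.1 hK.2.2
      (((P ∪ (Q ∩ C)) ∩ E) ∪ (Q ∩ D)) (Q ∩ C ∩ F)
      (((hP.isClosed.union (hQc.inter hC)).inter hE).union (hQc.inter hD))
      ((hQc.inter hC).inter hF)
      (by
        intro w hw
        rcases hKPQ hw with h | h
        · exact Or.inl (Or.inl ⟨Or.inl h, hPE h⟩)
        · rcases hQ h with h' | h'
          · rcases hEF (Or.inr ⟨h, h'⟩) with h'' | h''
            · exact Or.inl (Or.inl ⟨Or.inr ⟨h, h'⟩, h''⟩)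
            · exact Or.inr ⟨⟨h, h'⟩, h''⟩
          · exact Or.inl (Or.inr ⟨h, h'⟩))
      ⟨x, hPK hx, Or.inl ⟨Or.inl hx, hPE hx⟩⟩ ⟨f, hQK hf.1, hf, hfF⟩
    rcases hw with hw | hw
    · exact ⟨w, hw.1, hw.2, hwQ.2⟩
    · exact absurd (show w ∈ Q ∩ (C ∩ D) from ⟨hw.1, hwQ.1.2, hw.2⟩) (by simp [hCD])
  -- If `C` and `D` split `Q` and `y ∈ C`, then `P ∪ (Q ∩ C)` is a subcontinuum joining `x` to `y`,
  -- so it is all of `K` and nothing is left for `D`.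
  have key : ∀ C D : Set X, IsClosed C → IsClosed D → Q ⊆ C ∪ D → y ∈ C →
      (Q ∩ D).Nonempty → (Q ∩ (C ∩ D)).Nonempty := by
    intro C D hC hD hQ hyC ⟨d, hdQ, hdD⟩
    by_contra hne
    rw [Set.not_nonempty_iff_eq_empty] at hne
    have hconn : IsPreconnected (P ∪ (Q ∩ C)) := by
      rw [isPreconnected_closed_iff]
      intro E F hE hF hEF hnE hnF
      by_cases h : (P ∩ (E ∩ F)).Nonempty
      · exact h.mono fun w hw => ⟨Or.inl hw.1, hw.2⟩
      rcases hEF (Or.inl hx) with hxE | hxF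
      · refine glue C D E F hC hD hE hF hQ hne ?_ hEF hnF
        intro p hp
        by_contra hpE
        exact h (isPreconnected_closed_iff.1 hP.2.2 E F hE hF
          (Set.subset_union_left.trans hEF) ⟨x, hx, hxE⟩
          ⟨p, hp, (hEF (Or.inl hp)).resolve_left hpE⟩)
      · rw [Set.inter_comm E F]
        refine glue C D F E hC hD hF hE hQ hne ?_ (by rwa [Set.union_comm F E]) hnE
        intro p hp
        by_contra hpF
        exact h (isPreconnected_closed_iff.1 hP.2.2 E F hE hF
          (Set.subset_union_left.trans hEF)
          ⟨p, hp, (hEF (Or.inl hp)).resolve_right hpF⟩ ⟨x, hx, hxF⟩)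
    have hall := hirr (P ∪ (Q ∩ C))
      (Set.union_subset hPK (Set.inter_subset_left.trans hQK))
      ((hP.isClosed.union (hQc.inter hC)).isSubcontinuum hconn (x := x) (Or.inl hx)) (Or.inl hx)
      (Or.inr ⟨subset_closure hy, hyC⟩)
    have hQC : Q ⊆ C := closure_minimal (fun w hw => by
      have hw' : w ∈ P ∪ (Q ∩ C) := hall ▸ hw.1
      exact (hw'.resolve_left hw.2).2) hC
    have : d ∈ Q ∩ (C ∩ D) := ⟨hdQ, hQC hdQ, hdD⟩
    simp [hne] at this
  rw [isPreconnected_closed_iff]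
  intro C D hC hD hQ hnC hnD
  rcases hQ (subset_closure hy) with h | h
  · exact key C D hC hD hQ h hnD
  · rw [Set.inter_comm C D]
    exact key D C hD hC (by rwa [Set.union_comm]) h hnC

/-- If `P` is a proper subcontinuum of `K = continuumHull x y` containing `x`, then some
point of `P` lies in `closure (K \ P)`, and for each such point `z` the interior of `P` in `K` is
contained in `continuumHull x z`. -/
theorem HereditarilyUnicoherent.diff_closure_diff_subset_continuumHull [CompactSpace X]
    [ConnectedSpace X] (hX : HereditarilyUnicoherent X) (hP : IsSubcontinuum P)
    (hPK : P ⊆ continuumHull x y) (hne : P ≠ continuumHull x y) (hx : x ∈ P) :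
    (P ∩ closure (continuumHull x y \ P)).Nonempty ∧
    ∀ z ∈ P ∩ closure (continuumHull x y \ P),
      continuumHull x y \ closure (continuumHull x y \ P) ⊆ continuumHull x z := by
  have hK := hX.isSubcontinuum_continuumHull x y
  set K := continuumHull x y with hKdef
  have hirr : ∀ L ⊆ K, IsSubcontinuum L → x ∈ L → y ∈ L → L = K := fun L hLK hL hx hy =>
    hLK.antisymm (continuumHull_subset hL hx hy)
  have hyP : y ∉ P := fun h => hne (hirr P hPK hP hx h)
  have hyK : y ∈ K := right_mem_continuumHull x y
  have hQ := isPreconnected_closure_diff_of_irreducible hK hirr hP hPK hx ⟨hyK, hyP⟩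
  set Q := closure (K \ P)
  have hyQ : y ∈ Q := subset_closure ⟨hyK, hyP⟩
  have hQK : Q ⊆ K := closure_minimal Set.sdiff_subset hK.isClosed
  have hKPQ : K ⊆ P ∪ Q := fun w hw => by
    by_cases h : w ∈ P
    · exact Or.inl h
    · exact Or.inr (subset_closure ⟨hw, h⟩)
  refine ⟨?_, ?_⟩
  · obtain ⟨w, -, hw⟩ := isPreconnected_closed_iff.1 hK.2.2 P Q hP.isClosed isClosed_closure hKPQ
      ⟨x, hPK hx, hx⟩ ⟨y, hyK, hyQ⟩
    exact ⟨w, hw⟩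
  · rintro z ⟨-, hzQ⟩ w ⟨hwK, hwQ⟩
    have hH := hX.isSubcontinuum_continuumHull x z
    -- This union joins `x` to `y`, so it contains `K`.
    have hU : IsSubcontinuum (continuumHull x z ∪ Q) :=
      (hH.isClosed.union isClosed_closure).isSubcontinuum
        (hH.2.2.union z (right_mem_continuumHull x z) hzQ hQ) (Or.inr hyQ)
    exact (continuumHull_subset hU (Or.inl (left_mem_continuumHull x z)) (Or.inr hyQ)
      hwK).resolve_right hwQ

/-! ### Open meager composants -/

theorem HereditarilyUnicoherent.isPreconnected_meagerComposant_inter [CompactSpace X]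
    [ConnectedSpace X] (hX : HereditarilyUnicoherent X) (hK : IsSubcontinuum K) (hx : x ∈ K) :
    IsPreconnected (meagerComposant x ∩ K) := by
  refine isPreconnected_of_forall x fun z hz => ⟨continuumHull x z, ?_,
    left_mem_continuumHull x z, right_mem_continuumHull x z,
    (hX.isSubcontinuum_continuumHull x z).2.2⟩
  exact Set.subset_inter (hX.continuumHull_subset_meagerComposant hz.1)
    (continuumHull_subset hK hx hz.2)

theorem self_mem_meagerComposant [ConnectedSpace X] [Nontrivial X] (x : X) :
    x ∈ meagerComposant x := by
  refine ⟨{x}, ⟨⟨isCompact_singleton, isConnected_singleton⟩, ?_, rfl⟩, rfl⟩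
  have := ConnectedSpace.neBot_nhdsWithin_compl_of_nontrivial_of_t1space x
  rw [isClosed_singleton.isNowhereDense_iff]
  exact interior_singleton x

/-- If `P = closure (M ∩ K)` is not `K`, any `z` in `P ∩ closure (K \ P)` works: the open set `M`
misses `closure (K \ P)`, so `z ∉ M` and `M ∩ K` lies in the hull of `x` and `z`, which in turn lies
in `P`. -/
theorem HereditarilyUnicoherent.exists_continuumHull_subset_closure [CompactSpace X]
    [ConnectedSpace X] [Nontrivial X] (hX : HereditarilyUnicoherent X)
    (ho : IsOpen (meagerComposant x)) (hy : y ∉ meagerComposant x) :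
    ∃ z ∉ meagerComposant x,
      continuumHull x z ⊆ closure (meagerComposant x ∩ continuumHull x z) := by
  have hK := hX.isSubcontinuum_continuumHull x y
  set M := meagerComposant x
  set K := continuumHull x y
  set P := closure (M ∩ K)
  have hxM : x ∈ M := self_mem_meagerComposant x
  have hxK : x ∈ K := left_mem_continuumHull x y
  have hPK : P ⊆ K := closure_minimal Set.inter_subset_right hK.isClosed
  have hxP : x ∈ P := subset_closure ⟨hxM, hxK⟩
  by_cases hne : P = K
  · exact ⟨y, hy, hne.ge⟩
  have hP : IsSubcontinuum P := isClosed_closure.isSubcontinuum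
    (hX.isPreconnected_meagerComposant_inter (x := x) hK hxK).closure hxP
  have hMQ : Disjoint M (closure (K \ P)) := by
    refine Disjoint.closure_right ?_ ho
    rw [Set.disjoint_left]
    exact fun w hwM hw => hw.2 (subset_closure ⟨hwM, hw.1⟩)
  obtain ⟨⟨z, hzP, hzQ⟩, h⟩ := hX.diff_closure_diff_subset_continuumHull hP hPK hne hxP
  refine ⟨z, fun hzM => Set.disjoint_left.1 hMQ hzM hzQ, ?_⟩
  refine (continuumHull_subset hP hxP hzP).trans (closure_mono ?_)
  exact fun w hw => ⟨hw.1, h z ⟨hzP, hzQ⟩ ⟨hw.2, Set.disjoint_left.1 hMQ hw.1⟩⟩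

/-- Under the stated density, some proper subcontinuum of `continuumHull x y` containing `x` is
somewhere dense, since countably many of them cover a nonempty open set. -/
theorem HereditarilyUnicoherent.exists_subcontinuum_not_isNowhereDense [CompactSpace X]
    [ConnectedSpace X] [Nontrivial X] (hX : HereditarilyUnicoherent X)
    (ho : IsOpen (meagerComposant x)) (hy : y ∉ meagerComposant x)
    (hd : continuumHull x y ⊆ closure (meagerComposant x ∩ continuumHull x y)) :
    ∃ P ⊆ continuumHull x y, IsSubcontinuum P ∧ x ∈ P ∧ P ≠ continuumHull x y ∧
      ¬ IsNowhereDense P := by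
  have hK := hX.isSubcontinuum_continuumHull x y
  have hKn : ¬ IsNowhereDense (continuumHull x y) := fun h => hy (hX.mem_meagerComposant_iff.2 h)
  set M := meagerComposant x
  set K := continuumHull x y
  obtain ⟨k, hk⟩ : (interior K).Nonempty := by
    rwa [hK.isClosed.isNowhereDense_iff, ← ne_eq, ← Set.nonempty_iff_ne_empty] at hKn
  have hU : IsOpen (M ∩ interior K) := ho.inter isOpen_interior
  obtain ⟨u, huU, huM, -⟩ :=
    mem_closure_iff.1 (hd (interior_subset hk)) (interior K) isOpen_interior hk
  have hmeag : ¬ IsMeagre (M ∩ interior K) := not_isMeagre_of_isOpen hU ⟨u, huM, huU⟩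
  set I := {b ∈ TopologicalSpace.countableBasis X | (K ∩ b).Nonempty}
  have hI : I.Countable := (TopologicalSpace.countable_countableBasis X).mono (Set.sep_subset _ _)
  -- The hull of `x` and `z` is nowhere dense, so it omits a point of `K`, hence a basic open `b`
  -- around it, and lies in the component of `x` in `K \ b`.
  have hcov : M ∩ interior K ⊆ ⋃ b ∈ I, closure (connectedComponentIn (K \ b) x) := by
    rintro z ⟨hzM, hzK⟩
    have hHK : continuumHull x z ⊆ K :=
      continuumHull_subset hK (left_mem_continuumHull x y) (interior_subset hzK)
    have hH : ¬ K ⊆ continuumHull x z := fun h =>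
      hKn ((hX.mem_meagerComposant_iff.1 hzM).mono h)
    obtain ⟨w, hwK, hwH⟩ := Set.not_subset.1 hH
    obtain ⟨b, hb, hwb, hbH⟩ := (TopologicalSpace.isBasis_countableBasis X).exists_subset_of_mem_open
      hwH (isClosed_continuumHull x z).isOpen_compl
    have hHb : continuumHull x z ⊆ K \ b := fun v hv => ⟨hHK hv, fun hvb => hbH hvb hv⟩
    refine Set.mem_biUnion (x := b) ⟨hb, w, hwK, hwb⟩ (subset_closure ?_)
    exact (hX.isSubcontinuum_continuumHull x z).2.2.subset_connectedComponentIn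
      (left_mem_continuumHull x z) hHb (right_mem_continuumHull x z)
  obtain ⟨b, ⟨hb, w, hwK, hwb⟩, hbm⟩ :=
    exists_of_not_isMeagre_biUnion hI fun h => hmeag (h.mono hcov)
  have hsub : closure (connectedComponentIn (K \ b) x) ⊆ K \ b :=
    closure_minimal (connectedComponentIn_subset _ _)
      (hK.isClosed.sdiff (TopologicalSpace.isOpen_of_mem_countableBasis hb))
  have hxm : x ∈ K \ b := by
    by_contra h
    rw [connectedComponentIn_eq_empty h, closure_empty] at hbm
    exact hbm IsMeagre.empty
  have hxP : x ∈ closure (connectedComponentIn (K \ b) x) :=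
    subset_closure (mem_connectedComponentIn hxm)
  refine ⟨_, hsub.trans Set.sdiff_subset,
    isClosed_closure.isSubcontinuum isPreconnected_connectedComponentIn.closure hxP, hxP, ?_,
    fun h => hbm h.isMeagre⟩
  intro h
  exact (hsub (h.ge hwK)).2 hwb

theorem HereditarilyUnicoherent.meagerComposant_eq_univ_of_isOpen [CompactSpace X]
    [ConnectedSpace X] [Nontrivial X] (hX : HereditarilyUnicoherent X)
    (ho : IsOpen (meagerComposant x)) : meagerComposant x = Set.univ := by
  by_contra hM
  obtain ⟨y₀, hy₀⟩ := (Set.ne_univ_iff_exists_notMem _).1 hM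
  obtain ⟨y, hy, hd⟩ := hX.exists_continuumHull_subset_closure ho hy₀
  obtain ⟨P, hPK, hP, hxP, hne, hPn⟩ := hX.exists_subcontinuum_not_isNowhereDense ho hy hd
  have hK := hX.isSubcontinuum_continuumHull x y
  have hxK : x ∈ continuumHull x y := left_mem_continuumHull x y
  have hsub := (hX.diff_closure_diff_subset_continuumHull hP hPK hne hxP).2
  set M := meagerComposant x
  set K := continuumHull x y
  set Q := closure (K \ P)
  have hintQ : interior P ⊆ K \ Q := by
    intro w hw
    refine ⟨hPK (interior_subset hw), fun hwQ => ?_⟩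
    obtain ⟨v, hv, hv'⟩ := mem_closure_iff.1 hwQ _ isOpen_interior hw
    exact hv'.2 (interior_subset hv)
  have hintne : (interior P).Nonempty := by
    rwa [hP.isClosed.isNowhereDense_iff, ← ne_eq, ← Set.nonempty_iff_ne_empty] at hPn
  have hKPQ : K ⊆ P ∪ Q := fun w hw => by
    by_cases h : w ∈ P
    · exact Or.inl h
    · exact Or.inr (subset_closure ⟨hw, h⟩)
  -- For such `z` the hull of `x` and `z` contains `interior P`, so it is not nowhere dense.
  have hMPQ : ∀ z ∈ P ∩ Q, z ∉ M := fun z hz hzM => by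
    have hn := (hX.mem_meagerComposant_iff.1 hzM).mono (hintQ.trans (hsub z hz))
    have : interior P ⊆ interior (closure (interior P)) :=
      isOpen_interior.subset_interior_iff.2 subset_closure
    rw [IsNowhereDense] at hn
    exact hintne.not_subset_empty (hn ▸ this)
  have hMP : M ∩ K ⊆ P := by
    intro w hw
    by_contra hwP
    obtain ⟨v, hv, hvPQ⟩ := isPreconnected_closed_iff.1
      (hX.isPreconnected_meagerComposant_inter hK hxK) P Q hP.isClosed isClosed_closure
      (Set.inter_subset_right.trans hKPQ) ⟨x, ⟨self_mem_meagerComposant x, hxK⟩, hxP⟩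
      ⟨w, hw, subset_closure ⟨hw.2, hwP⟩⟩
    exact hMPQ v hvPQ hv.1
  exact hne (hPK.antisymm (hd.trans (closure_minimal hMP hP.isClosed)))

end Hull

theorem corollary5 {X : Type*} [MetricSpace X] [CompactSpace X] [ConnectedSpace X] [Nontrivial X]
    (hX : IsTreeLike X) :
    ¬ ∃ M : Set X, IsMeagerComposant M ∧ IsOpen M ∧ M ≠ Set.univ := by
  rintro ⟨_, ⟨x, rfl⟩, ho, hne⟩
  have hU : HereditarilyUnicoherent X := fun _ _ hA hB cA cB => hX.isPreconnected_inter hA hB cA cB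
  exact hne (hU.meagerComposant_eq_univ_of_isOpen ho)
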